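/- Let $\lambda$ be a limit ordinal and let $j\colon V_\lambda\to V_\lambda$ be an elementary embedding (for the language $\{\in\}$) that is not the identity. For maps $a,b\colon V_\lambda\to V_\lambda$ in what follows, the application $a(b)$ is the map $V_\lambda\to V_\lambda$ whose graph is $\bigcup_{\alpha<\lambda}a(b\cap V_\alpha)$, where $b\cap V_\alpha$ is the set of those pairs $(x,b(x))$ that are elements of $V_\alpha$. The algebra generated by $j$ is the smallest family of maps that contains $j$ and is closed under application $(a,b)\mapsto a(b)$ and composition $(a,b)\mapsto a\circ b$. The critical point of a map is the least ordinal it moves. Let $\kappa_0$ be the critical point of $j$, let $\kappa_{n+1}=j(\kappa_n)$, and let $F(n)\in\mathbb N\cup\{\infty\}$ be the number of ordinals below $\kappa_n$ that are critical points of members of the algebra generated by $j$. Let $F_0,F_1,F_2,\dots$ be the functions on the natural numbers given by $F_0(m)=m+1$, $F_{n+1}(0)=F_n(1)$, $F_{n+1}(m+1)=F_n(F_{n+1}(m))$ (the Ackermann–Péter hierarchy). Then $$F(4)>F_9(F_8(F_8(254))).$$ In particular $F(4)>F_9(F_8(F_4(254)))$ and $F(4)>F_4(F_4(254))>F_5(1)$.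 -/

import Mathlib

universe u

namespace EmbeddingAlgebra

/-- The symbols of the first-order language of set theory: one binary relation symbol. -/
inductive SetRel : ℕ → Type
  | mem : SetRel 2

/-- The first-order language of set theory (equality is a logical symbol). -/
def setLanguage : FirstOrder.Language.{0, 0} := ⟨fun _ => Empty, SetRel⟩

/-- The rank-initial segment `V_lam` of the universe of sets, as a type. -/
abbrev VSet (lam : Ordinal.{u}) : Type (u + 1) := {x : ZFSet.{u} // x ∈ ZFSet.vonNeumann lam}

/-- `V_lam` as a structure for the language of set theory, with the true membership relation. -/
instance vSetStructure (lam : Ordinal.{u}) : setLanguage.Structure (VSet lam) where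
  funMap := fun f => Empty.elim f
  RelMap := fun r => match r with
    | SetRel.mem => fun v => (v 0).1 ∈ (v 1).1

variable {lam : Ordinal.{u}}

/-- `b ∩ V_α`: the set of all pairs `(x, b x)`, with `x` in `V_lam`, that are elements of `V_α`;
for `α < lam` this is itself an element of `V_lam`. -/
noncomputable def graphSegment (b : VSet lam → VSet lam) (α : Ordinal.{u}) (hα : α < lam) : VSet lam :=
  ⟨ZFSet.sep (fun p => ∃ x : VSet lam, p = ZFSet.pair x.1 (b x).1) (ZFSet.vonNeumann α),
    ZFSet.mem_vonNeumann_of_subset ZFSet.sep_subset (ZFSet.vonNeumann_mem_of_lt hα)⟩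

/-- `c` is the result `a(b)` of applying `a` to `b`: the graph of `c` is the union of the sets
`a(b ∩ V_α)` over all `α < lam`. This determines `c`; when `a` and `b` are elementary and `lam` is
a limit, it is the usual application of elementary embeddings of `V_lam` to itself. -/
def IsApplication (a b c : VSet lam → VSet lam) : Prop :=
  ∀ x y : VSet lam, c x = y ↔
    ∃ (α : Ordinal.{u}) (hα : α < lam), ZFSet.pair x.1 y.1 ∈ (a (graphSegment b α hα)).1

/-- The algebra generated by `j`: the least family of self-maps of `V_lam` that contains `j` and is
closed under application and under composition. -/
inductive Generated (j : VSet lam → VSet lam) : (VSet lam → VSet lam) → Prop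
  | gen : Generated j j
  | app {a b c : VSet lam → VSet lam} :
      Generated j a → Generated j b → IsApplication a b c → Generated j c
  | comp {a b : VSet lam → VSet lam} :
      Generated j a → Generated j b → Generated j (a ∘ b)

/-- `γ` is the critical point of `e`: the first ordinal that `e` moves. -/
def IsCriticalPoint (e : VSet lam → VSet lam) (γ : VSet lam) : Prop :=
  γ.1.IsOrdinal ∧ e γ ≠ γ ∧ ∀ β : VSet lam, β.1 ∈ γ.1 → e β = β

/-- The critical points of members of the algebra generated by `j` that lie below `κ_n`, where
`κ_0` is the critical point of `j` and `κ_(n+1) = j(κ_n)`. -/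
def criticalPointsBelow (j : VSet lam → VSet lam) (n : ℕ) : Set (VSet lam) :=
  {γ | (∃ e, Generated j e ∧ IsCriticalPoint e γ) ∧
    ∃ κ₀, IsCriticalPoint j κ₀ ∧ γ.1 ∈ (j^[n] κ₀).1}

/-- `F(n)`: the number of critical points of members of the algebra that lie below `κ_n`. -/
noncomputable def numCriticalPoints (j : VSet lam → VSet lam) (n : ℕ) : ℕ∞ :=
  (criticalPointsBelow j n).encard

end EmbeddingAlgebra

/-!
For an embedding `e`, write `e : α ↦ β` for `e α = β`. The maps of the algebra satisfy
`a(b)(a x) = a(b x)`, and `a(b)` fixes all ordinals below `a γ` if `b` fixes all ordinals below `γ`.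
These two rules, monotonicity on the ordinals and closure under composition are all that the count
of critical points uses; they are collected in `IsApplicative`.

Let `κ₀ = crit j` and `κ₁ = j κ₀`. For `f` in the algebra, `f κ₀` is the critical point of `f(j)`.
So critical points are counted by chains of successive intervals `[f κ₀, f κ₁]` above `κ₁`
(`Chain`). The source of growth is `Raises.succ`: if `t : κ₀ ↦ A` and `t : κ₁ ↦ Z`, then for a
chain of `n` maps `f` that ends at or below `A`, the maps `t(f)` have critical point `A` and carry
`[A, Z]` into `n` successive intervals between `Z` and `t A`. If chains grow from `A` to `Z` as
`ack k` does, and this is inherited by the copies, then from `A` to `t A` they grow as `ack (k + 1)`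
does.

To have many such `t` with the same `A`, one finds `U`, `Q` in the algebra and an ordinal `y` with
`U : y ↦ κ₄` and `Q : κ₀ ↦ y, κ₁ ↦ U κ₀, y ↦ U κ₁`, where `U κ₀ > y`. Then `t = U(f) ∘ Q` satisfies
`t : κ₀ ↦ y, κ₁ ↦ U (f κ₀), y ↦ U (f κ₁)`, so every member `f` of a chain ending at or below `y`
increases the level `k` by one. A chain of length `n` up to `y` therefore yields one of length
`ack (n + 1) n` up to `U y = κ₄` (`Chain.ack_succ_self`). A chain of length `12` up to `y` is
written down explicitly (`exists_long_chain`), and `ack 13 12` exceeds the required bounds.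

On the set-theoretic side, elementary embeddings of `V_lam` are shown to be closed under
application. The elementarity of `b` for one formula, restricted to `b ∩ V_α`, is a first-order
property of the set `b ∩ V_α`, so `a` transfers it (`IsApplication.exists_elementary`).
-/

namespace EmbeddingAlgebra

/-! ### Algebras of strictly monotone maps -/

/-- A set of strictly monotone self-maps of a linear order that contains the identity and is closed
under composition and under an application `c = a(b)`. Of the application only two traces are kept:
`c` carries the `a`-image of `x` to the `a`-image of `b x`, and if `b` fixes everything below `γ`
then `c` fixes everything below `a γ`. -/
structure IsApplicative {I : Type*} [LinearOrder I] (G : Set (I → I)) : Prop where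
  id_mem : id ∈ G
  strictMono : ∀ a ∈ G, StrictMono a
  comp_mem : ∀ a ∈ G, ∀ b ∈ G, a ∘ b ∈ G
  exists_app : ∀ a ∈ G, ∀ b ∈ G, ∃ c ∈ G, (∀ x, c (a x) = a (b x)) ∧
    ∀ γ, (∀ x < γ, b x = x) → ∀ x < a γ, c x = x

section Combinatorics

variable {I : Type*} [LinearOrder I]

/-- `Chain G κ₀ κ₁ n β`: above `κ₁` and up to `β` there are `n` successive intervals
`[f κ₀, f κ₁]` with `f ∈ G`, which overlap in endpoints at most. -/
inductive Chain (G : Set (I → I)) (κ₀ κ₁ : I) : ℕ → I → Prop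
  | zero {β : I} : κ₁ ≤ β → Chain G κ₀ κ₁ 0 β
  | succ {n : ℕ} {α β : I} {f : I → I} : Chain G κ₀ κ₁ n α → f ∈ G → α ≤ f κ₀ → f κ₁ ≤ β →
      Chain G κ₀ κ₁ (n + 1) β

/-- The step from `A` to `B` raises the length of chains at least as fast as `ack k`, and so does
its image under every `F ∈ G` that fixes the points up to `κ₁`. -/
def Raises (G : Set (I → I)) (κ₀ κ₁ : I) (k : ℕ) (A B : I) : Prop :=
  ∀ F ∈ G, (∀ x ≤ κ₁, F x = x) → ∀ n, 1 ≤ n → Chain G κ₀ κ₁ n (F A) →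
    Chain G κ₀ κ₁ (ack k n) (F B)

variable {G : Set (I → I)} {κ₀ κ₁ : I}

lemma Chain.mono {n : ℕ} {α β : I} (h : Chain G κ₀ κ₁ n α) (hαβ : α ≤ β) :
    Chain G κ₀ κ₁ n β := by
  cases h with
  | zero h => exact .zero (h.trans hαβ)
  | succ h hf h0 h1 => exact .succ h hf h0 (h1.trans hαβ)

lemma Chain.of_le (hG : IsApplicative G) (h01 : κ₀ < κ₁) {m n : ℕ} {β : I}
    (h : Chain G κ₀ κ₁ n β) (hmn : m ≤ n) : Chain G κ₀ κ₁ m β := by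
  induction h with
  | zero h =>
    obtain rfl : m = 0 := by omega
    exact .zero h
  | @succ n α β f h hf h0 h1 ih =>
    rcases Nat.lt_or_ge m (n + 1) with hm | hm
    · exact (ih (by omega)).mono ((h0.trans (hG.strictMono _ hf h01).le).trans h1)
    · obtain rfl := le_antisymm hmn hm
      exact .succ h hf h0 h1

/-- The lower endpoints of the intervals of a chain are distinct. -/
lemma Chain.exists_finset (hG : IsApplicative G) (h01 : κ₀ < κ₁) {n : ℕ} {β : I}
    (h : Chain G κ₀ κ₁ n β) :
    ∃ s : Finset I, s.card = n ∧ ∀ γ ∈ s, γ < β ∧ ∃ f ∈ G, f κ₀ = γ := by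
  induction h with
  | zero h => exact ⟨∅, rfl, by simp⟩
  | @succ n α β f h hf h0 h1 ih =>
    obtain ⟨s, hs, hsα⟩ := ih
    have hf01 := hG.strictMono f hf h01
    refine ⟨insert (f κ₀) s, ?_, ?_⟩
    · rw [Finset.card_insert_of_notMem, hs]
      exact fun hmem => ((hsα _ hmem).1.trans_le h0).false
    · intro γ hγ
      rcases Finset.mem_insert.1 hγ with rfl | hγ
      · exact ⟨hf01.trans_le h1, f, hf, rfl⟩
      · exact ⟨(hsα γ hγ).1.trans_le (h0.trans (hf01.le.trans h1)), (hsα γ hγ).2⟩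

lemma Raises.mono (hG : IsApplicative G) {k : ℕ} {A B B' : I} (h : Raises G κ₀ κ₁ k A B)
    (hB : B ≤ B') : Raises G κ₀ κ₁ k A B' :=
  fun F hF hfix n hn hc => (h F hF hfix n hn hc).mono ((hG.strictMono F hF).monotone hB)

lemma raises_zero (hG : IsApplicative G) (h01 : κ₀ < κ₁) {t : I → I} (ht : t ∈ G) :
    Raises G κ₀ κ₁ 0 (t κ₀) (t κ₁) := by
  intro F hF hfix n _ hc
  obtain ⟨c, hcG, hcF, -⟩ := hG.exists_app F hF t ht
  rw [ack_zero]
  refine .succ hc hcG (le_of_eq ?_) (le_of_eq ?_)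
  · rw [← hcF, hfix κ₀ h01.le]
  · rw [← hcF, hfix κ₁ le_rfl]

/-- If `t` carries `κ₀` to `A` and the step from `A` to `Z ≤ t κ₁` has growth rate `k`, then the
step from `A` to `t A` has growth rate `k + 1`: the interval `[A, t κ₁]` is copied, by the
applications of `t` to the members of a chain below `A`, into that many successive intervals
between `A` and `t A`, and every copy applies `ack k` once. -/
lemma Raises.succ (hG : IsApplicative G) (h01 : κ₀ < κ₁)
    (hfix₀ : ∀ a ∈ G, ∀ x < κ₀, a x = x) {k : ℕ} {A Z : I} {t : I → I} (ht : t ∈ G)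
    (htA : t κ₀ = A) (hA : κ₁ < A) (hZ : Z ≤ t κ₁) (h : Raises G κ₀ κ₁ k A Z) :
    Raises G κ₀ κ₁ (k + 1) A (t A) := by
  intro F hF hfix n hn hc
  obtain ⟨c, hcG, hcF, -⟩ := hG.exists_app F hF t ht
  have hmF := (hG.strictMono F hF).monotone
  have hmc := (hG.strictMono c hcG).monotone
  have hc₀ : c κ₀ = F A := by rw [← htA, ← hcF, hfix κ₀ h01.le]
  have hc₁ : F Z ≤ c κ₁ := by
    rw [← hfix κ₁ le_rfl, hcF]
    exact hmF hZ
  have key : ∀ i β, Chain G κ₀ κ₁ i β → Chain G κ₀ κ₁ (ack (k + 1) i) (c β) := by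
    intro i β hi
    induction hi with
    | zero hβ =>
      rw [ack_succ_zero]
      exact ((h F hF hfix n hn hc).mono (hc₁.trans (hmc hβ))).of_le hG h01 (ack_mono_right k hn)
    | @succ i α β f _ hf h0 h1 ih =>
      obtain ⟨d, hdG, hdc, hd⟩ := hG.exists_app c hcG f hf
      have hdfix := hd κ₀ (hfix₀ f hf)
      have hdA : d (F A) = c (f κ₀) := by rw [← hc₀, hdc]
      have hdZ : d (F Z) ≤ c (f κ₁) := by
        rw [← hdc]
        exact (hG.strictMono d hdG).monotone hc₁
      have hκF : κ₁ < c κ₀ := by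
        rw [hc₀, ← hfix κ₁ le_rfl]
        exact hG.strictMono F hF hA
      rw [ack_succ_succ]
      refine (h (d ∘ F) (hG.comp_mem d hdG F hF) ?_ _ (ack_pos _ _) ?_).mono
        (hdZ.trans (hmc h1))
      · intro x hx
        rw [Function.comp_apply, hfix x hx, hdfix x (hx.trans_lt hκF)]
      · exact ih.mono ((hmc h0).trans_eq hdA.symm)
  rw [← hcF]
  exact key n (F A) hc

/-- A chain up to `y` is used twice to get a chain up to `U y`: its members `f` give, through
`U(f) ∘ Q`, steps whose growth rates increase by one each time, and its length is the argument to
which the last step is applied. -/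
lemma Chain.ack_succ_self (hG : IsApplicative G) (h01 : κ₀ < κ₁) (hfix₀ : ∀ a ∈ G, ∀ x < κ₀, a x = x)
    {U Q : I → I} {y : I} (hU : U ∈ G) (hQ : Q ∈ G) (hQ₀ : Q κ₀ = y) (hQ₁ : Q κ₁ = U κ₀)
    (hQy : Q y = U κ₁) (hy : κ₁ < y) (hyU : y < U κ₀) {n : ℕ} (hn : 1 ≤ n)
    (h : Chain G κ₀ κ₁ n y) : Chain G κ₀ κ₁ (ack (n + 1) n) (U y) := by
  have hmU := (hG.strictMono U hU).monotone
  have h0 : Raises G κ₀ κ₁ 0 y (U κ₀) := by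
    have := raises_zero hG h01 hQ
    rwa [hQ₀, hQ₁] at this
  have h1 : Raises G κ₀ κ₁ 1 y (U κ₁) := by
    have := Raises.succ hG h01 hfix₀ hQ hQ₀ hy hQ₁.ge h0
    rwa [hQy] at this
  have key : ∀ i β, Chain G κ₀ κ₁ i β → Raises G κ₀ κ₁ (i + 1) y (U β) := by
    intro i β hi
    induction hi with
    | zero hβ => exact h1.mono hG (hmU hβ)
    | @succ i α β f _ hf hα hβ ih =>
      obtain ⟨d, hdG, hdU, hd⟩ := hG.exists_app U hU f hf
      have hdy : d y = y := hd κ₀ (hfix₀ f hf) y hyU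
      have := Raises.succ hG h01 hfix₀ (hG.comp_mem d hdG Q hQ) (A := y)
        (by rw [Function.comp_apply, hQ₀, hdy]) hy
        (by rw [Function.comp_apply, hQ₁, hdU]; exact hmU hα) ih
      rw [Function.comp_apply, hQy, hdU] at this
      exact this.mono hG (hmU hβ)
  exact key n y h id hG.id_mem (fun _ _ => rfl) n hn h

/-- If `j` has critical point `κ₀` then there is a chain of length `ack 13 12` up to the fourth
iterate of `j` at `κ₀`. All ordinals in the proof are the iterates `k₁, k₂, k₃, k₄` of `j` at `κ₀`,
an ordinal `e` between `k₂` and `k₃`, and an ordinal `y` between `k₃` and `k₄`. -/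
lemma exists_long_chain (hG : IsApplicative G) {j : I → I} (hj : j ∈ G)
    (hfix₀ : ∀ a ∈ G, ∀ x < κ₀, a x = x) (hκ : κ₀ < j κ₀) :
    Chain G κ₀ (j κ₀) (ack 13 12) (j (j (j (j κ₀)))) := by
  have mono : ∀ {a}, a ∈ G → ∀ {x y}, x < y → a x < a y := fun ha _ _ hxy =>
    hG.strictMono _ ha hxy
  obtain ⟨k₁, h₁⟩ : ∃ k, j κ₀ = k := ⟨_, rfl⟩
  obtain ⟨k₂, h₂⟩ : ∃ k, j k₁ = k := ⟨_, rfl⟩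
  obtain ⟨k₃, h₃⟩ : ∃ k, j k₂ = k := ⟨_, rfl⟩
  obtain ⟨k₄, h₄⟩ : ∃ k, j k₃ = k := ⟨_, rfl⟩
  rw [h₁] at hκ
  rw [h₁, h₂, h₃, h₄]
  have hk₁₂ : k₁ < k₂ := by simpa only [h₁, h₂] using mono hj hκ
  have hk₂₃ : k₂ < k₃ := by simpa only [h₂, h₃] using mono hj hk₁₂
  -- `p = j(j)`, `q = p(j)`, `r = q(j)`, `u = r(q)`
  obtain ⟨p, hp, hpj, hpfix⟩ := hG.exists_app j hj j hj
  have hp₀ : p κ₀ = κ₀ := hpfix κ₀ (hfix₀ j hj) κ₀ (by rwa [h₁])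
  have hp₁ : p k₁ = k₂ := by rw [← h₁, hpj, h₁, h₂]
  have hp₂ : p k₂ = k₃ := by rw [← h₂, hpj, h₂, h₃]
  have hp₃ : p k₃ = k₄ := by rw [← h₃, hpj, h₃, h₄]
  obtain ⟨q, hq, hqp, -⟩ := hG.exists_app p hp j hj
  have hq₀ : q κ₀ = k₂ := by rw [← hp₀, hqp, h₁, hp₁]
  have hq₂ : q k₂ = k₃ := by rw [← hp₁, hqp, h₂, hp₂]
  have hq₃ : q k₃ = k₄ := by rw [← hp₂, hqp, h₃, hp₃]
  obtain ⟨e, he⟩ : ∃ e, q k₁ = e := ⟨_, rfl⟩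
  have hk₂e : k₂ < e := by rw [← hq₀, ← he]; exact mono hq hκ
  obtain ⟨r, hr, hrq, hrfix⟩ := hG.exists_app q hq j hj
  have hr₀ : r κ₀ = κ₀ := hrfix κ₀ (hfix₀ j hj) κ₀ (by rw [hq₀]; exact hκ.trans hk₁₂)
  have hr₁ : r k₁ = k₁ := hrfix κ₀ (hfix₀ j hj) k₁ (by rwa [hq₀])
  have hr₂ : r k₂ = e := by rw [← hq₀, hrq, h₁, he]
  have hre : r e = k₃ := by rw [← he, hrq, h₂, hq₂]
  have hr₃ : r k₃ = k₄ := by rw [← hq₂, hrq, h₃, hq₃]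
  obtain ⟨u, hu, hur, -⟩ := hG.exists_app r hr q hq
  have hu₀ : u κ₀ = e := by
    have := hur κ₀
    rwa [hr₀, hq₀, hr₂] at this
  have hu₁ : u k₁ = k₃ := by
    have := hur k₁
    rwa [hr₁, he, hre] at this
  have hue : u e = k₄ := by
    have := hur k₂
    rwa [hr₂, hq₂, hr₃] at this
  obtain ⟨y, hy⟩ : ∃ y, u k₂ = y := ⟨_, rfl⟩
  have hk₃y : k₃ < y := by rw [← hu₁, ← hy]; exact mono hu hk₁₂
  -- `f = u(j)`, `s = f(r)`, `a = s(j)`: the map `a` takes `κ₀, k₁, k₃` to `k₁, k₃, y`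
  obtain ⟨f, hf, hfu, hffix⟩ := hG.exists_app u hu j hj
  have hf₂ : f k₂ = k₂ := hffix κ₀ (hfix₀ j hj) k₂ (by rwa [hu₀])
  have hfe : f e = k₃ := by
    have := hfu κ₀
    rwa [hu₀, h₁, hu₁] at this
  have hf₃ : f k₃ = y := by
    have := hfu k₁
    rwa [hu₁, h₂, hy] at this
  have hr_fix : ∀ x < k₂, r x = x := by
    have := hrfix κ₀ (hfix₀ j hj)
    rwa [hq₀] at this
  obtain ⟨s, hs, hsf, hsfix⟩ := hG.exists_app f hf r hr
  have hs₀ : s κ₀ = κ₀ := hsfix k₂ hr_fix κ₀ (by rw [hf₂]; exact hκ.trans hk₁₂)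
  have hs₁ : s k₁ = k₁ := hsfix k₂ hr_fix k₁ (by rwa [hf₂])
  have hs₂ : s k₂ = k₃ := by
    have := hsf k₂
    rwa [hf₂, hr₂, hfe] at this
  have hs₃ : s k₃ = y := by
    have := hsf e
    rwa [hfe, hre, hf₃] at this
  obtain ⟨a, ha, has, -⟩ := hG.exists_app s hs j hj
  have ha₀ : a κ₀ = k₁ := by
    have := has κ₀
    rwa [hs₀, h₁, hs₁] at this
  have ha₁ : a k₁ = k₃ := by
    have := has k₁
    rwa [hs₁, h₂, hs₂] at this
  have ha₃ : a k₃ = y := by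
    have := has k₂
    rwa [hs₂, h₃, hs₃] at this
  -- the maps `j, q, u` cut `[k₁, k₃]` into three intervals; images of this subdivision
  have block : ∀ {g n}, g ∈ G → Chain G κ₀ k₁ n (g k₁) → Chain G κ₀ k₁ (n + 3) (g k₃) := by
    intro g n hg h
    have c₁ : Chain G κ₀ k₁ (n + 1) (g k₂) :=
      .succ h (hG.comp_mem g hg j hj) (by simp [h₁]) (by simp [h₂])
    have c₂ : Chain G κ₀ k₁ (n + 2) (g e) :=
      .succ c₁ (hG.comp_mem g hg q hq) (by simp [hq₀]) (by simp [he])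
    exact .succ c₂ (hG.comp_mem g hg u hu) (by simp [hu₀]) (by simp [hu₁])
  have block' : ∀ {h n}, h ∈ G → Chain G κ₀ k₁ n (a (h κ₀)) →
      Chain G κ₀ k₁ (n + 3) (a (h k₁)) := by
    intro h n hh hc
    obtain ⟨b, hb, hba, -⟩ := hG.exists_app a ha h hh
    have hb₁ : b k₁ = a (h κ₀) := by rw [← hba, ha₀]
    have hb₃ : b k₃ = a (h k₁) := by rw [← hba, ha₁]
    have := block hb (hb₁ ▸ hc)
    rwa [hb₃] at this
  have c₃ : Chain G κ₀ k₁ 3 k₃ := block hG.id_mem (.zero le_rfl)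
  have c₆ : Chain G κ₀ k₁ 6 (a k₂) := by
    have := block' (n := 3) hj (by rwa [h₁, ha₁])
    rwa [h₂] at this
  have c₉ : Chain G κ₀ k₁ 9 (a e) := by
    have := block' (n := 6) hq (by rwa [hq₀])
    rwa [he] at this
  have c₁₂ : Chain G κ₀ k₁ 12 y := by
    have := block' (n := 9) hu (by rwa [hu₀])
    rwa [hu₁, ha₃] at this
  -- `v = u(q)` and `w = v(r)`: the map `w` takes `k₂, y` to `y, k₄` and fixes `κ₀, k₁`
  obtain ⟨v, hv, hvu, hvfix⟩ := hG.exists_app u hu q hq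
  have hv₂ : v k₂ = k₂ := hvfix κ₀ (hfix₀ q hq) k₂ (by rwa [hu₀])
  have hve : v e = y := by
    have := hvu κ₀
    rwa [hu₀, hq₀, hy] at this
  have hv₃ : v k₃ = k₄ := by
    have := hvu k₁
    rwa [hu₁, he, hue] at this
  obtain ⟨w, hw, hwv, hwfix⟩ := hG.exists_app v hv r hr
  have hw₀ : w κ₀ = κ₀ := hwfix k₂ hr_fix κ₀ (by rw [hv₂]; exact hκ.trans hk₁₂)
  have hw₁ : w k₁ = k₁ := hwfix k₂ hr_fix k₁ (by rwa [hv₂])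
  have hw₂ : w k₂ = y := by
    have := hwv k₂
    rwa [hv₂, hr₂, hve] at this
  have hwy : w y = k₄ := by
    have := hwv e
    rwa [hve, hre, hv₃] at this
  -- `U = w(u)` and `Q = w(q)` satisfy the hypotheses of `Chain.ack_succ_self`
  obtain ⟨U, hU, hUw, -⟩ := hG.exists_app w hw u hu
  have hU₀ : U κ₀ = w e := by
    have := hUw κ₀
    rwa [hw₀, hu₀] at this
  have hU₁ : U k₁ = w k₃ := by
    have := hUw k₁
    rwa [hw₁, hu₁] at this
  have hUy : U y = k₄ := by
    have := hUw k₂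
    rwa [hw₂, hy, hwy] at this
  obtain ⟨Q, hQ, hQw, -⟩ := hG.exists_app w hw q hq
  have hQ₀ : Q κ₀ = y := by
    have := hQw κ₀
    rwa [hw₀, hq₀, hw₂] at this
  have hQ₁ : Q k₁ = U κ₀ := by
    have := hQw k₁
    rwa [hw₁, he, ← hU₀] at this
  have hQy : Q y = U k₁ := by
    have := hQw k₂
    rwa [hw₂, hq₂, ← hU₁] at this
  have := Chain.ack_succ_self hG hκ hfix₀ hU hQ hQ₀ hQ₁ hQy (hk₁₂.trans (hk₂₃.trans hk₃y))
    (by rw [hU₀, ← hw₂]; exact mono hw hk₂e) (by norm_num) c₁₂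
  rwa [hUy] at this

end Combinatorics

variable {lam : Ordinal.{u}}

open FirstOrder FirstOrder.Language

/-! ### Relations definable in `V_lam` -/

/-- A relation on `V_lam`, on variables indexed by `ℕ`, that is defined by a first-order formula
without parameters. -/
def IsDefinable (P : (ℕ → VSet lam) → Prop) : Prop :=
  ∃ φ : setLanguage.Formula ℕ, ∀ v, φ.Realize v ↔ P v

namespace IsDefinable

variable {P Q : (ℕ → VSet lam) → Prop}

lemma apply_iff (hP : IsDefinable P) (e : VSet lam ↪ₑ[setLanguage] VSet lam) (v : ℕ → VSet lam) :
    P (e ∘ v) ↔ P v := by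
  obtain ⟨φ, hφ⟩ := hP
  rw [← hφ, ← hφ, e.map_formula]

lemma congr (hP : IsDefinable P) (h : ∀ v, P v ↔ Q v) : IsDefinable Q := by
  obtain ⟨φ, hφ⟩ := hP
  exact ⟨φ, fun v => (hφ v).trans (h v)⟩

lemma mem (i k : ℕ) : IsDefinable fun v : ℕ → VSet lam => (v i).1 ∈ (v k).1 := by
  refine ⟨Relations.formula (show setLanguage.Relations 2 from SetRel.mem)
    ![Term.var i, Term.var k], fun v => ?_⟩
  exact Formula.realize_rel.trans Iff.rfl

lemma eq (i k : ℕ) : IsDefinable fun v : ℕ → VSet lam => v i = v k :=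
  ⟨Term.equal (Term.var i) (Term.var k), fun v => by simp [Formula.realize_equal]⟩

lemma not (hP : IsDefinable P) : IsDefinable fun v => ¬ P v := by
  obtain ⟨φ, hφ⟩ := hP
  exact ⟨φ.not, fun v => by rw [Formula.realize_not, hφ]⟩

lemma imp (hP : IsDefinable P) (hQ : IsDefinable Q) : IsDefinable fun v => P v → Q v := by
  obtain ⟨φ, hφ⟩ := hP
  obtain ⟨ψ, hψ⟩ := hQ
  exact ⟨φ.imp ψ, fun v => by rw [Formula.realize_imp, hφ, hψ]⟩

lemma and (hP : IsDefinable P) (hQ : IsDefinable Q) : IsDefinable fun v => P v ∧ Q v :=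
  (hP.imp hQ.not).not.congr fun v => by tauto

lemma or (hP : IsDefinable P) (hQ : IsDefinable Q) : IsDefinable fun v => P v ∨ Q v :=
  (hP.not.imp hQ).congr fun v => by tauto

lemma iff (hP : IsDefinable P) (hQ : IsDefinable Q) : IsDefinable fun v => (P v ↔ Q v) :=
  ((hP.imp hQ).and (hQ.imp hP)).congr fun v => by tauto

lemma all (k : ℕ) (hP : IsDefinable P) :
    IsDefinable fun v => ∀ x, P (Function.update v k x) := by
  obtain ⟨φ, hφ⟩ := hP
  refine ⟨Formula.iAlls Unit
    (φ.relabel fun i => if i = k then Sum.inr () else Sum.inl i), fun v => ?_⟩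
  have hv : ∀ w : Unit → VSet lam,
      (Sum.elim v w ∘ fun i => if i = k then Sum.inr () else Sum.inl i) =
        Function.update v k (w ()) := by
    intro w
    ext i : 1
    by_cases hi : i = k <;> simp [hi]
  rw [Formula.realize_iAlls]
  simp only [Formula.realize_relabel, hv, hφ]
  exact ⟨fun h x => h fun _ => x, fun h w => h (w ())⟩

lemma ex (k : ℕ) (hP : IsDefinable P) :
    IsDefinable fun v => ∃ x, P (Function.update v k x) :=
  (hP.not.all k).not.congr fun v => by simp

lemma comp (hP : IsDefinable P) (σ : ℕ → ℕ) : IsDefinable fun v => P (v ∘ σ) := by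
  obtain ⟨φ, hφ⟩ := hP
  exact ⟨φ.relabel σ, fun v => by rw [Formula.realize_relabel, hφ]⟩

end IsDefinable

lemma mem_vonNeumann_of_mem {x y : ZFSet.{u}} (h : x ∈ y) (hy : y ∈ ZFSet.vonNeumann lam) :
    x ∈ ZFSet.vonNeumann lam :=
  (ZFSet.isTransitive_vonNeumann lam).subset_of_mem hy h

/-- Two members of `V_lam` with the same members in `V_lam` are equal. -/
lemma VSet.ext_mem {x y : VSet lam} (h : ∀ z : VSet lam, z.1 ∈ x.1 ↔ z.1 ∈ y.1) : x = y := by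
  apply Subtype.ext
  ext z
  exact ⟨fun hz => (h ⟨z, mem_vonNeumann_of_mem hz x.2⟩).1 hz,
    fun hz => (h ⟨z, mem_vonNeumann_of_mem hz y.2⟩).2 hz⟩

/-- Kuratowski pairs are described by quantification over `V_lam`. -/
lemma eq_pair_iff {p x y : VSet lam} (hp : ZFSet.pair x.1 y.1 ∈ ZFSet.vonNeumann lam) :
    p.1 = ZFSet.pair x.1 y.1 ↔ ∀ z : VSet lam, z.1 ∈ p.1 ↔
      ((∀ w : VSet lam, w.1 ∈ z.1 ↔ w = x) ∨ ∀ w : VSet lam, w.1 ∈ z.1 ↔ w = x ∨ w = y) := by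
  have hmem : ∀ z : VSet lam, z.1 ∈ ZFSet.pair x.1 y.1 ↔
      ((∀ w : VSet lam, w.1 ∈ z.1 ↔ w = x) ∨ ∀ w : VSet lam, w.1 ∈ z.1 ↔ w = x ∨ w = y) := by
    intro z
    rw [ZFSet.pair, ZFSet.mem_pair]
    refine or_congr ?_ ?_
    · constructor
      · intro h w
        rw [h, ZFSet.mem_singleton, Subtype.ext_iff]
      · intro h
        ext w
        rw [ZFSet.mem_singleton]
        constructor
        · intro hw
          exact congrArg Subtype.val ((h ⟨w, mem_vonNeumann_of_mem hw z.2⟩).1 hw)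
        · rintro rfl
          exact (h x).2 rfl
    · constructor
      · intro h w
        rw [h, ZFSet.mem_pair, Subtype.ext_iff, Subtype.ext_iff]
      · intro h
        ext w
        rw [ZFSet.mem_pair]
        constructor
        · intro hw
          exact ((h ⟨w, mem_vonNeumann_of_mem hw z.2⟩).1 hw).imp
            (congrArg Subtype.val) (congrArg Subtype.val)
        · rintro (rfl | rfl)
          · exact (h x).2 (.inl rfl)
          · exact (h y).2 (.inr rfl)
  constructor
  · intro h z
    rw [h, hmem]
  · intro h
    have : p = ⟨ZFSet.pair x.1 y.1, hp⟩ := VSet.ext_mem fun z => (h z).trans (hmem z).symm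
    exact congrArg Subtype.val this

lemma rank_pair_le (x y : ZFSet.{u}) :
    (ZFSet.pair x y).rank ≤ Order.succ (Order.succ (max x.rank y.rank)) := by
  simp only [ZFSet.pair, ZFSet.rank_pair, ZFSet.rank_singleton]
  refine max_le ?_ ?_ <;> gcongr
  · exact le_max_left _ _
  · exact max_le (Order.succ_le_succ (le_max_left _ _)) (Order.succ_le_succ (le_max_right _ _))

lemma pair_mem_vonNeumann (hlam : Order.IsSuccLimit lam) (x y : VSet lam) :
    ZFSet.pair x.1 y.1 ∈ ZFSet.vonNeumann lam := by
  rw [ZFSet.mem_vonNeumann]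
  refine (rank_pair_le x.1 y.1).trans_lt (hlam.succ_lt (hlam.succ_lt (max_lt ?_ ?_)))
  · exact ZFSet.mem_vonNeumann.1 x.2
  · exact ZFSet.mem_vonNeumann.1 y.2

namespace IsDefinable

lemma pair_mem (hlam : Order.IsSuccLimit lam) (i k l : ℕ) :
    IsDefinable fun v : ℕ → VSet lam => ZFSet.pair (v i).1 (v k).1 ∈ (v l).1 := by
  have h : IsDefinable fun v : ℕ → VSet lam => ZFSet.pair (v 0).1 (v 1).1 ∈ (v 2).1 := by
    -- variable `3` is the pair, `4` a member of it, `5` a member of a member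
    refine IsDefinable.congr (((((mem 4 3).iff ((((mem 5 4).iff (eq 5 0)).all 5).or
      (((mem 5 4).iff ((eq 5 0).or (eq 5 1))).all 5))).all 4).and (mem 3 2)).ex 3) fun v => ?_
    simp only [Function.update_apply, Nat.reduceEqDiff, OfNat.zero_ne_ofNat, OfNat.one_ne_ofNat,
      if_true, if_false]
    simp only [← eq_pair_iff (pair_mem_vonNeumann hlam (v 0) (v 1))]
    constructor
    · rintro ⟨p, hp, hm⟩
      rwa [← hp]
    · intro hm
      exact ⟨⟨_, pair_mem_vonNeumann hlam (v 0) (v 1)⟩, rfl, hm⟩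
  exact h.comp fun n => if n = 0 then i else if n = 1 then k else l

end IsDefinable

/-! ### What elementary embeddings of `V_lam` preserve -/

section Preservation

variable (e : VSet lam ↪ₑ[setLanguage] VSet lam)

lemma map_mem_iff {x y : VSet lam} : (e x).1 ∈ (e y).1 ↔ x.1 ∈ y.1 :=
  (IsDefinable.mem 0 1).apply_iff e fun n => if n = 0 then x else y

lemma map_pair_mem_iff (hlam : Order.IsSuccLimit lam) {x y g : VSet lam} :
    ZFSet.pair (e x).1 (e y).1 ∈ (e g).1 ↔ ZFSet.pair x.1 y.1 ∈ g.1 :=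
  (IsDefinable.pair_mem hlam 0 1 2).apply_iff e fun n => if n = 0 then x else if n = 1 then y else g

lemma subset_iff {x y : VSet lam} : x.1 ⊆ y.1 ↔ ∀ z : VSet lam, z.1 ∈ x.1 → z.1 ∈ y.1 :=
  ⟨fun h _ hz => h hz, fun h z hz => h ⟨z, mem_vonNeumann_of_mem hz x.2⟩ hz⟩

lemma isDefinable_subset :
    IsDefinable fun v : ℕ → VSet lam => (v 0).1 ⊆ (v 1).1 := by
  refine IsDefinable.congr (((IsDefinable.mem 2 0).imp (IsDefinable.mem 2 1)).all 2) fun v => ?_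
  simp only [Function.update_apply, OfNat.zero_ne_ofNat, OfNat.one_ne_ofNat, if_true, if_false]
  exact subset_iff.symm

lemma map_subset_iff {x y : VSet lam} : (e x).1 ⊆ (e y).1 ↔ x.1 ⊆ y.1 :=
  isDefinable_subset.apply_iff e fun n => if n = 0 then x else y

lemma map_powerset {x y : VSet lam} (h : y.1 = ZFSet.powerset x.1) :
    (e y).1 = ZFSet.powerset (e x).1 := by
  have hdef : IsDefinable fun v : ℕ → VSet lam =>
      ∀ z : VSet lam, z.1 ∈ (v 1).1 ↔ z.1 ⊆ (v 0).1 := by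
    refine IsDefinable.congr (((IsDefinable.mem 2 1).iff
      (isDefinable_subset.comp fun n => if n = 0 then 2 else 0)).all 2) fun v => ?_
    simp
  have := (hdef.apply_iff e fun n => if n = 0 then x else y).2 (by simp [h])
  ext z
  rw [ZFSet.mem_powerset]
  constructor
  · intro hz
    exact (this ⟨z, mem_vonNeumann_of_mem hz (e y).2⟩).1 hz
  · intro hz
    exact (this ⟨z, ZFSet.mem_vonNeumann_of_subset hz (e x).2⟩).2 hz

/-- A relation in `V_lam` that is single-valued is mapped to a single-valued one. -/
lemma map_singleValued (hlam : Order.IsSuccLimit lam) {g : VSet lam}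
    (h : ∀ x y z : VSet lam, ZFSet.pair x.1 y.1 ∈ g.1 → ZFSet.pair x.1 z.1 ∈ g.1 → y = z)
    (x y z : VSet lam) (hy : ZFSet.pair x.1 y.1 ∈ (e g).1) (hz : ZFSet.pair x.1 z.1 ∈ (e g).1) :
    y = z := by
  have hdef : IsDefinable fun v : ℕ → VSet lam => ∀ x y z : VSet lam,
      ZFSet.pair x.1 y.1 ∈ (v 0).1 → ZFSet.pair x.1 z.1 ∈ (v 0).1 → y = z := by
    refine IsDefinable.congr (((((IsDefinable.pair_mem hlam 1 2 0).imp
      ((IsDefinable.pair_mem hlam 1 3 0).imp (IsDefinable.eq 2 3))).all 3).all 2).all 1)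
      fun v => ?_
    simp
  exact (hdef.apply_iff e fun _ => g).2 h x y z hy hz

/-- A relation in `V_lam` defined everywhere on `w` is mapped to one defined everywhere on
`e w`. -/
lemma map_total (hlam : Order.IsSuccLimit lam) {g w : VSet lam}
    (h : ∀ x : VSet lam, x.1 ∈ w.1 → ∃ y : VSet lam, ZFSet.pair x.1 y.1 ∈ g.1)
    (x : VSet lam) (hx : x.1 ∈ (e w).1) : ∃ y : VSet lam, ZFSet.pair x.1 y.1 ∈ (e g).1 := by
  have hdef : IsDefinable fun v : ℕ → VSet lam => ∀ x : VSet lam, x.1 ∈ (v 1).1 →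
      ∃ y : VSet lam, ZFSet.pair x.1 y.1 ∈ (v 0).1 := by
    refine IsDefinable.congr (((IsDefinable.mem 2 1).imp
      ((IsDefinable.pair_mem hlam 2 3 0).ex 3)).all 2) fun v => ?_
    simp
  exact (hdef.apply_iff e fun n => if n = 0 then g else w).2 h x hx

/-- A relation in `V_lam` that contains the identity on `w` is mapped to one that contains the
identity on `e w`. -/
lemma map_diagonal (hlam : Order.IsSuccLimit lam) {g w : VSet lam}
    (h : ∀ x : VSet lam, x.1 ∈ w.1 → ZFSet.pair x.1 x.1 ∈ g.1)
    (x : VSet lam) (hx : x.1 ∈ (e w).1) : ZFSet.pair x.1 x.1 ∈ (e g).1 := by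
  have hdef : IsDefinable fun v : ℕ → VSet lam => ∀ x : VSet lam, x.1 ∈ (v 1).1 →
      ZFSet.pair x.1 x.1 ∈ (v 0).1 := by
    refine IsDefinable.congr (((IsDefinable.mem 2 1).imp
      (IsDefinable.pair_mem hlam 2 2 0)).all 2) fun v => ?_
    simp
  exact (hdef.apply_iff e fun n => if n = 0 then g else w).2 h x hx

lemma isTransitive_iff {x : VSet lam} : x.1.IsTransitive ↔
    ∀ y : VSet lam, y.1 ∈ x.1 → ∀ z : VSet lam, z.1 ∈ y.1 → z.1 ∈ x.1 :=
  ⟨fun h _ hy _ hz => h _ hy hz, fun h y hy z hz =>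
    have hy' := mem_vonNeumann_of_mem hy x.2
    h ⟨y, hy'⟩ hy ⟨z, mem_vonNeumann_of_mem hz hy'⟩ hz⟩

lemma isDefinable_isTransitive : IsDefinable fun v : ℕ → VSet lam => (v 0).1.IsTransitive := by
  refine IsDefinable.congr (((IsDefinable.mem 1 0).imp
    (((IsDefinable.mem 2 1).imp (IsDefinable.mem 2 0)).all 2)).all 1) fun v => ?_
  rw [isTransitive_iff]
  simp

lemma map_isTransitive {x : VSet lam} (h : x.1.IsTransitive) : (e x).1.IsTransitive :=
  (isDefinable_isTransitive.apply_iff e fun _ => x).2 h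

lemma map_isOrdinal {x : VSet lam} (h : x.1.IsOrdinal) : (e x).1.IsOrdinal := by
  have hdef : IsDefinable fun v : ℕ → VSet lam =>
      ∀ y : VSet lam, y.1 ∈ (v 0).1 → y.1.IsTransitive := by
    refine IsDefinable.congr (((IsDefinable.mem 1 0).imp
      (isDefinable_isTransitive.comp fun _ => 1)).all 1) fun v => ?_
    simp
  rw [ZFSet.isOrdinal_iff_forall_mem_isTransitive] at h ⊢
  refine ⟨map_isTransitive e h.1, fun y hy => ?_⟩
  exact (hdef.apply_iff e fun _ => x).2 (fun y hy => h.2 _ hy)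
    ⟨y, mem_vonNeumann_of_mem hy (e x).2⟩ hy

/-- `V_γ` as an element of `V_lam`. -/
noncomputable def stage (γ : Ordinal.{u}) (hγ : γ < lam) : VSet lam :=
  ⟨ZFSet.vonNeumann γ, ZFSet.vonNeumann_mem_of_lt hγ⟩

/-- `V_γ ⊆ e(V_γ)`: by induction on `γ`, since `e` maps powersets to powersets. -/
lemma vonNeumann_subset_map_stage (hlam : Order.IsSuccLimit lam) (γ : Ordinal.{u}) (hγ : γ < lam) :
    ZFSet.vonNeumann γ ⊆ (e (stage γ hγ)).1 := by
  induction γ using WellFoundedLT.induction with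
  | _ γ ih =>
    intro x hx
    obtain ⟨δ, hδ, hxδ⟩ := ZFSet.mem_vonNeumann'.1 hx
    have hδ' : Order.succ δ < lam := hlam.succ_lt (hδ.trans hγ)
    have hpow := map_powerset e (x := stage δ (hδ.trans hγ)) (y := stage (Order.succ δ) hδ')
      (ZFSet.vonNeumann_add_one δ)
    have hsub : (e (stage (Order.succ δ) hδ')).1 ⊆ (e (stage γ hγ)).1 :=
      (map_subset_iff e).2 (ZFSet.vonNeumann_subset_of_le (Order.succ_le_of_lt hδ))
    apply hsub
    rw [hpow, ZFSet.mem_powerset]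
    exact fun z hz => ih δ hδ _ (hxδ hz)

end Preservation

/-! ### Application of elementary embeddings -/

lemma pair_mem_graphSegment {b : VSet lam → VSet lam} {α : Ordinal.{u}} {hα : α < lam}
    {x y : VSet lam} : ZFSet.pair x.1 y.1 ∈ (graphSegment b α hα).1 ↔
      b x = y ∧ ZFSet.pair x.1 y.1 ∈ ZFSet.vonNeumann α := by
  rw [graphSegment, ZFSet.mem_sep, and_comm]
  refine and_congr_left fun _ => ⟨?_, ?_⟩
  · rintro ⟨z, hz⟩
    obtain ⟨h1, h2⟩ := ZFSet.pair_injective hz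
    obtain rfl := Subtype.ext h1
    exact (Subtype.ext h2).symm
  · rintro rfl
    exact ⟨x, rfl⟩

lemma graphSegment_mono (b : VSet lam → VSet lam) {α β : Ordinal.{u}} (hα : α < lam) (hβ : β < lam)
    (h : α ≤ β) : (graphSegment b α hα).1 ⊆ (graphSegment b β hβ).1 := by
  intro p hp
  rw [graphSegment, ZFSet.mem_sep] at hp ⊢
  exact ⟨ZFSet.vonNeumann_subset_of_le h hp.1, hp.2⟩

/-- The restriction of an elementary embedding `b` to `V_β` is contained in some `b ∩ V_α`. -/
lemma exists_graphSegment (hlam : Order.IsSuccLimit lam) (b : VSet lam ↪ₑ[setLanguage] VSet lam)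
    {β : Ordinal.{u}} (hβ : β < lam) : ∃ (α : Ordinal.{u}) (hα : α < lam), ∀ x : VSet lam,
      x.1 ∈ ZFSet.vonNeumann β → ZFSet.pair x.1 (b x).1 ∈ (graphSegment b α hα).1 := by
  have hbβ : (b (stage β hβ)).1.rank < lam := ZFSet.mem_vonNeumann.1 (b (stage β hβ)).2
  refine ⟨Order.succ (Order.succ (max β (b (stage β hβ)).1.rank)),
    hlam.succ_lt (hlam.succ_lt (max_lt hβ hbβ)), fun x hx => ?_⟩
  rw [pair_mem_graphSegment]
  refine ⟨rfl, ?_⟩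
  rw [ZFSet.mem_vonNeumann]
  refine (rank_pair_le _ _).trans_lt ?_
  rw [Order.succ_lt_succ_iff, Order.succ_lt_succ_iff]
  refine max_lt_max (ZFSet.mem_vonNeumann.1 hx) (ZFSet.rank_lt_of_mem ?_)
  exact (map_mem_iff b).2 hx

lemma map_graphSegment_mono (a b : VSet lam ↪ₑ[setLanguage] VSet lam) {α β : Ordinal.{u}}
    (hα : α < lam) (hβ : β < lam) (h : α ≤ β) :
    (a (graphSegment b α hα)).1 ⊆ (a (graphSegment b β hβ)).1 :=
  (map_subset_iff a).2 (graphSegment_mono b hα hβ h)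

/-- The union of the sets `a(b ∩ V_α)` is a function. -/
lemma eq_of_pair_mem_map_graphSegment (hlam : Order.IsSuccLimit lam)
    (a b : VSet lam ↪ₑ[setLanguage] VSet lam) {α β : Ordinal.{u}} {hα : α < lam} {hβ : β < lam}
    {x y z : VSet lam} (hy : ZFSet.pair x.1 y.1 ∈ (a (graphSegment b α hα)).1)
    (hz : ZFSet.pair x.1 z.1 ∈ (a (graphSegment b β hβ)).1) : y = z := by
  have hmax : max α β < lam := max_lt hα hβ
  refine map_singleValued a hlam (g := graphSegment b (max α β) hmax) ?_ x y z
    (map_graphSegment_mono a b hα hmax (le_max_left _ _) hy)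
    (map_graphSegment_mono a b hβ hmax (le_max_right _ _) hz)
  intro x y z hy hz
  rw [pair_mem_graphSegment] at hy hz
  exact hy.1.symm.trans hz.1

/-- The application of an elementary embedding to an elementary embedding exists. -/
lemma exists_isApplication (hlam : Order.IsSuccLimit lam)
    (a b : VSet lam ↪ₑ[setLanguage] VSet lam) : ∃ c, IsApplication a b c := by
  have htot : ∀ x : VSet lam, ∃ (y : VSet lam) (α : Ordinal.{u}) (hα : α < lam),
      ZFSet.pair x.1 y.1 ∈ (a (graphSegment b α hα)).1 := by
    intro x
    have hβ : Order.succ x.1.rank < lam := hlam.succ_lt (ZFSet.mem_vonNeumann.1 x.2)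
    obtain ⟨α, hα, h⟩ := exists_graphSegment hlam b hβ
    obtain ⟨y, hy⟩ := map_total a hlam (w := stage _ hβ) (fun z hz => ⟨b z, h z hz⟩) x
      (vonNeumann_subset_map_stage a hlam _ hβ (ZFSet.mem_vonNeumann_succ x.1))
    exact ⟨y, α, hα, hy⟩
  choose c hc using htot
  refine ⟨c, fun x y => ⟨?_, ?_⟩⟩
  · rintro rfl
    exact hc x
  · rintro ⟨β, hβ, hy⟩
    obtain ⟨α, hα, hx⟩ := hc x
    exact eq_of_pair_mem_map_graphSegment hlam a b hx hy

namespace IsApplication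

variable {a b : VSet lam ↪ₑ[setLanguage] VSet lam} {c : VSet lam → VSet lam}

lemma apply_apply (h : IsApplication a b c) (hlam : Order.IsSuccLimit lam) (x : VSet lam) :
    c (a x) = a (b x) := by
  have hβ : Order.succ x.1.rank < lam := hlam.succ_lt (ZFSet.mem_vonNeumann.1 x.2)
  obtain ⟨α, hα, hx⟩ := exists_graphSegment hlam b hβ
  rw [h]
  exact ⟨α, hα, (map_pair_mem_iff a hlam).2 (hx x (ZFSet.mem_vonNeumann_succ x.1))⟩

/-- If `b` fixes all members of `w` then `a(b)` fixes all members of `a w`. -/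
lemma eq_self_of_mem (h : IsApplication a b c) (hlam : Order.IsSuccLimit lam) {w : VSet lam}
    (hw : ∀ z : VSet lam, z.1 ∈ w.1 → b z = z) (z : VSet lam) (hz : z.1 ∈ (a w).1) : c z = z := by
  obtain ⟨α, hα, hx⟩ := exists_graphSegment hlam b (ZFSet.mem_vonNeumann.1 w.2)
  rw [h]
  refine ⟨α, hα, map_diagonal a hlam (w := w) (fun x hxw => ?_) z hz⟩
  have := hx x (ZFSet.subset_vonNeumann_self w.1 hxw)
  rwa [hw x hxw] at this

/-- The application of elementary embeddings is elementary: the elementarity of `b` for a formula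
`φ`, restricted to `b ∩ V_α`, is itself expressed by a formula, which `a` transfers to
`a(b ∩ V_α)`. -/
lemma exists_elementary (h : IsApplication a b c) (hlam : Order.IsSuccLimit lam) :
    ∃ e : VSet lam ↪ₑ[setLanguage] VSet lam, ⇑e = c := by
  refine ⟨⟨c, fun n φ x => ?_⟩, rfl⟩
  have hx : ∀ i, ∃ (α : Ordinal.{u}) (hα : α < lam),
      ZFSet.pair (x i).1 (c (x i)).1 ∈ (a (graphSegment b α hα)).1 := fun i => (h _ _).1 rfl
  choose α hα hx using hx
  have hsup : Finset.univ.sup α < lam :=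
    (Finset.sup_lt_iff hlam.bot_lt).2 fun i _ => hα i
  obtain ⟨π, hπ⟩ := IsDefinable.pair_mem hlam 0 1 2
  let σ : Fin n → ℕ → Unit ⊕ (Fin n ⊕ Fin n) := fun i k =>
    if k = 0 then .inr (.inl i) else if k = 1 then .inr (.inr i) else .inl ()
  let ψ : setLanguage.Formula Unit := Formula.iAlls (Fin n ⊕ Fin n)
    ((Formula.iInf fun i => π.relabel (σ i)).imp
      ((φ.relabel fun i => Sum.inr (Sum.inl i)).iff (φ.relabel fun i => Sum.inr (Sum.inr i))))
  have hψ : ∀ g : VSet lam, ψ.Realize (fun _ => g) ↔ ∀ v w : Fin n → VSet lam,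
      (∀ i, ZFSet.pair (v i).1 (w i).1 ∈ g.1) → (φ.Realize v ↔ φ.Realize w) := by
    intro g
    simp only [ψ, Formula.realize_iAlls, Formula.realize_imp, Formula.realize_iInf,
      Formula.realize_iff, Formula.realize_relabel, hπ]
    constructor
    · intro H v w hvw
      exact H (Sum.elim v w) fun i => by simpa [σ] using hvw i
    · intro H vw hvw
      exact H (vw ∘ Sum.inl) (vw ∘ Sum.inr) fun i => by simpa [σ] using hvw i
  have hb : ψ.Realize fun _ => graphSegment b _ hsup := by
    rw [hψ]
    intro v w hvw
    obtain rfl : b ∘ v = w := funext fun i => (pair_mem_graphSegment.1 (hvw i)).1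
    exact (b.map_formula φ v).symm
  have ha := (a.map_formula ψ _).2 hb
  exact ((hψ _).1 ha x (c ∘ x) fun i => map_graphSegment_mono a b (hα i) hsup
    (Finset.le_sup (Finset.mem_univ i)) (hx i)).symm

end IsApplication

lemma Generated.exists_elementary (hlam : Order.IsSuccLimit lam)
    {j : VSet lam ↪ₑ[setLanguage] VSet lam} {e : VSet lam → VSet lam} (h : Generated j e) :
    ∃ E : VSet lam ↪ₑ[setLanguage] VSet lam, ⇑E = e := by
  induction h with
  | gen => exact ⟨j, rfl⟩
  | app _ _ h iha ihb =>
    obtain ⟨a, rfl⟩ := iha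
    obtain ⟨b, rfl⟩ := ihb
    exact h.exists_elementary hlam
  | comp _ _ iha ihb =>
    obtain ⟨a, rfl⟩ := iha
    obtain ⟨b, rfl⟩ := ihb
    exact ⟨a.comp b, rfl⟩

/-- Members of the algebra generated by `j` fix everything that lies below a set all of whose
members are fixed by `j`. -/
lemma Generated.eq_self_of_mem (hlam : Order.IsSuccLimit lam)
    {j : VSet lam ↪ₑ[setLanguage] VSet lam} {w : VSet lam}
    (hw : ∀ z : VSet lam, z.1 ∈ w.1 → j z = z) {e : VSet lam → VSet lam} (h : Generated j e) :
    ∀ z : VSet lam, z.1 ∈ w.1 → e z = z := by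
  induction h with
  | gen => exact hw
  | app ha hb h iha ihb =>
    intro z hz
    obtain ⟨a, rfl⟩ := ha.exists_elementary hlam
    obtain ⟨b, rfl⟩ := hb.exists_elementary hlam
    refine h.eq_self_of_mem hlam ihb z ?_
    rw [← iha z hz]
    exact (map_mem_iff a).2 hz
  | comp _ _ iha ihb =>
    intro z hz
    rw [Function.comp_apply, ihb z hz, iha z hz]

/-! ### The critical point -/

/-- Ranks strictly increase along `∈`, so a transitive set whose members are labelled by members of
`g`, in a way that turns membership into membership, has rank at most the rank of `g`. -/
lemma rank_lt_of_labelling {D g s : VSet lam}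
    (hD : D.1.IsTransitive)
    (htot : ∀ z : VSet lam, z.1 ∈ D.1 → ∃ β : VSet lam, β.1 ∈ g.1 ∧ ZFSet.pair z.1 β.1 ∈ s.1)
    (hmono : ∀ z β z' β' : VSet lam, ZFSet.pair z.1 β.1 ∈ s.1 → ZFSet.pair z'.1 β'.1 ∈ s.1 →
      z'.1 ∈ z.1 → β'.1 ∈ β.1) {z : VSet lam} (hz : z.1 ∈ D.1) : z.1.rank < g.1.rank := by
  have key : ∀ z : ZFSet.{u}, ∀ hz : z ∈ ZFSet.vonNeumann lam, z ∈ D.1 → ∀ β : VSet lam,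
      ZFSet.pair z β.1 ∈ s.1 → z.rank ≤ β.1.rank := by
    intro z
    induction z using ZFSet.inductionOn with
    | _ z ih =>
      intro hz hzD β hβ
      rw [ZFSet.rank_le_iff]
      intro y hy
      have hyV := mem_vonNeumann_of_mem hy hz
      have hyD := hD.subset_of_mem hzD hy
      obtain ⟨β', -, hβ'⟩ := htot ⟨y, hyV⟩ hyD
      exact (ih y hy hyV hyD β' hβ').trans_lt
        (ZFSet.rank_lt_of_mem (hmono ⟨z, hz⟩ β ⟨y, hyV⟩ β' hβ hβ' hy))
  obtain ⟨β, hβ, hs⟩ := htot z hz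
  exact (key z.1 z.2 hz β hs).trans_lt (ZFSet.rank_lt_of_mem hβ)

/-- An ordinal below `lam` as an element of `V_lam`. -/
noncomputable def ordSet (o : Set.Iio lam) : VSet lam :=
  ⟨o.1.toZFSet, by rw [ZFSet.mem_vonNeumann, Ordinal.rank_toZFSet]; exact o.2⟩

lemma ordSet_mem_iff {o o' : Set.Iio lam} : (ordSet o).1 ∈ (ordSet o').1 ↔ o < o' :=
  Ordinal.toZFSet_mem_toZFSet_iff

lemma ordSet_injective : Function.Injective (ordSet (lam := lam)) := fun _ _ h =>
  Subtype.ext (Ordinal.toZFSet_injective (congrArg Subtype.val h))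

lemma exists_ordSet_eq {x : VSet lam} (h : x.1.IsOrdinal) : ∃ o, ordSet o = x :=
  ⟨⟨x.1.rank, ZFSet.mem_vonNeumann.1 x.2⟩, Subtype.ext h.toZFSet_rank_eq⟩

/-- An elementary embedding of `V_lam` that fixes all ordinals is the identity. -/
lemma eq_self_of_forall_ordSet (hlam : Order.IsSuccLimit lam)
    (j : VSet lam ↪ₑ[setLanguage] VSet lam) (hj : ∀ o, j (ordSet o) = ordSet o) (x : VSet lam) :
    j x = x := by
  obtain ⟨γ, hγ⟩ : ∃ γ, x.1.rank = γ := ⟨_, rfl⟩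
  induction γ using WellFoundedLT.induction generalizing x with
  | _ γ ih =>
    have hγlam : γ < lam := hγ ▸ ZFSet.mem_vonNeumann.1 x.2
    let g : VSet lam := ordSet ⟨γ, hγlam⟩
    let D := stage γ hγlam
    -- the rank function on `V_γ`, as an element of `V_lam`
    have hsep : ∀ p : ZFSet.{u} → Prop, ∃ s : VSet lam,
        s.1 = ZFSet.sep p (ZFSet.vonNeumann (Order.succ (Order.succ γ))) := fun p =>
      ⟨⟨ZFSet.sep p _, ZFSet.mem_vonNeumann_of_subset ZFSet.sep_subset
        (ZFSet.vonNeumann_mem_of_lt (hlam.succ_lt (hlam.succ_lt hγlam)))⟩, rfl⟩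
    obtain ⟨s, hs₀⟩ := hsep fun p => ∃ z : VSet lam, p = ZFSet.pair z.1 z.1.rank.toZFSet
    have hs : ∀ z β : VSet lam, ZFSet.pair z.1 β.1 ∈ s.1 → β.1 = z.1.rank.toZFSet := by
      intro z β hzβ
      rw [hs₀, ZFSet.mem_sep] at hzβ
      obtain ⟨y, hy⟩ := hzβ.2
      obtain ⟨h1, h2⟩ := ZFSet.pair_injective hy
      rw [h2, ← h1]
    have htot : ∀ z : VSet lam, z.1 ∈ D.1 →
        ∃ β : VSet lam, β.1 ∈ g.1 ∧ ZFSet.pair z.1 β.1 ∈ s.1 := by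
      intro z hz
      have hzγ : z.1.rank < γ := ZFSet.mem_vonNeumann.1 hz
      refine ⟨ordSet ⟨z.1.rank, hzγ.trans hγlam⟩, ordSet_mem_iff.2 hzγ, ?_⟩
      rw [hs₀, ZFSet.mem_sep, ZFSet.mem_vonNeumann]
      refine ⟨?_, z, rfl⟩
      refine (rank_pair_le _ _).trans_lt ?_
      rw [Order.succ_lt_succ_iff, Order.succ_lt_succ_iff]
      exact max_lt hzγ (by rwa [ordSet, Ordinal.rank_toZFSet])
    have hmono : ∀ z β z' β' : VSet lam, ZFSet.pair z.1 β.1 ∈ s.1 →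
        ZFSet.pair z'.1 β'.1 ∈ s.1 → z'.1 ∈ z.1 → β'.1 ∈ β.1 := by
      intro z β z' β' h h' hzz
      rw [hs z β h, hs z' β' h', Ordinal.toZFSet_mem_toZFSet_iff]
      exact ZFSet.rank_lt_of_mem hzz
    have htot' : ∀ z : VSet lam, z.1 ∈ (j D).1 →
        ∃ β : VSet lam, β.1 ∈ (j g).1 ∧ ZFSet.pair z.1 β.1 ∈ (j s).1 := by
      have hdef : IsDefinable fun v : ℕ → VSet lam => ∀ z : VSet lam, z.1 ∈ (v 0).1 →
          ∃ β : VSet lam, β.1 ∈ (v 1).1 ∧ ZFSet.pair z.1 β.1 ∈ (v 2).1 := by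
        refine IsDefinable.congr (((IsDefinable.mem 3 0).imp
          (((IsDefinable.mem 4 1).and (IsDefinable.pair_mem hlam 3 4 2)).ex 4)).all 3)
          fun v => ?_
        simp
      exact (hdef.apply_iff j fun n => if n = 0 then D else if n = 1 then g else s).2 htot
    have hmono' : ∀ z β z' β' : VSet lam, ZFSet.pair z.1 β.1 ∈ (j s).1 →
        ZFSet.pair z'.1 β'.1 ∈ (j s).1 → z'.1 ∈ z.1 → β'.1 ∈ β.1 := by
      have hdef : IsDefinable fun v : ℕ → VSet lam => ∀ z β z' β' : VSet lam,
          ZFSet.pair z.1 β.1 ∈ (v 0).1 → ZFSet.pair z'.1 β'.1 ∈ (v 0).1 → z'.1 ∈ z.1 →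
          β'.1 ∈ β.1 := by
        refine IsDefinable.congr ((((((IsDefinable.pair_mem hlam 1 2 0).imp
          ((IsDefinable.pair_mem hlam 3 4 0).imp ((IsDefinable.mem 3 1).imp
          (IsDefinable.mem 4 2)))).all 4).all 3).all 2).all 1) fun v => ?_
        simp
      exact (hdef.apply_iff j fun _ => s).2 hmono
    -- so all members of `j(V_γ)` have rank below `j γ = γ`, and hence are fixed by `j`
    have hsmall : ∀ z : VSet lam, z.1 ∈ (j D).1 → j z = z := by
      intro z hz
      refine ih _ ?_ z rfl
      have := rank_lt_of_labelling
        (map_isTransitive j (x := D) (ZFSet.isTransitive_vonNeumann γ)) htot' hmono' hz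
      rwa [hj, ordSet, Ordinal.rank_toZFSet] at this
    have hxD : (j x).1 ⊆ (j D).1 := by
      rw [map_subset_iff]
      exact ZFSet.subset_vonNeumann.2 hγ.le
    refine VSet.ext_mem fun z => ⟨fun hz => ?_, fun hz => ?_⟩
    · rw [← hsmall z (hxD hz)] at hz
      exact (map_mem_iff j).1 hz
    · rw [← ih _ (hγ ▸ ZFSet.rank_lt_of_mem hz) z rfl]
      exact (map_mem_iff j).2 hz

/-- An elementary embedding of `V_lam` other than the identity has a critical point. -/
lemma exists_isCriticalPoint (hlam : Order.IsSuccLimit lam)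
    (j : VSet lam ↪ₑ[setLanguage] VSet lam) (hj : ∃ x, j x ≠ x) :
    ∃ o : Set.Iio lam, IsCriticalPoint j (ordSet o) := by
  have hne : ∃ o, j (ordSet o) ≠ ordSet o := by
    by_contra! h
    obtain ⟨x, hx⟩ := hj
    exact hx (eq_self_of_forall_ordSet hlam j h x)
  obtain ⟨o, ho, hmin⟩ := WellFounded.has_min (r := ((· < ·) : Set.Iio lam → Set.Iio lam → Prop))
    wellFounded_lt {o | j (ordSet o) ≠ ordSet o} hne
  refine ⟨o, ZFSet.isOrdinal_toZFSet _, ho, fun β hβ => ?_⟩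
  obtain ⟨o', rfl⟩ := exists_ordSet_eq ((ZFSet.isOrdinal_toZFSet _).mem hβ)
  by_contra h
  exact hmin o' h (ordSet_mem_iff.1 hβ)

/-! ### The action of the algebra on the ordinals below `lam` -/

/-- The maps on the ordinals below `lam` that are induced by the identity and by the members of the
algebra generated by `j`. -/
def ordinalActions (j : VSet lam → VSet lam) : Set (Set.Iio lam → Set.Iio lam) :=
  {f | ∃ e : VSet lam ↪ₑ[setLanguage] VSet lam, (⇑e = id ∨ Generated j e) ∧
    ∀ o, e (ordSet o) = ordSet (f o)}

lemma exists_action (e : VSet lam ↪ₑ[setLanguage] VSet lam) :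
    ∃ f : Set.Iio lam → Set.Iio lam, ∀ o, e (ordSet o) = ordSet (f o) := by
  have h : ∀ o, ∃ o', ordSet o' = e (ordSet o) := fun o =>
    exists_ordSet_eq (map_isOrdinal e (ZFSet.isOrdinal_toZFSet o.1))
  choose f hf using h
  exact ⟨f, fun o => (hf o).symm⟩

lemma isApplicative_ordinalActions (hlam : Order.IsSuccLimit lam)
    (j : VSet lam ↪ₑ[setLanguage] VSet lam) : IsApplicative (ordinalActions j) where
  id_mem := ⟨ElementaryEmbedding.refl _ _, .inl rfl, fun _ => rfl⟩
  strictMono := by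
    rintro f ⟨e, -, he⟩ o o' h
    rw [← ordSet_mem_iff, ← he, ← he, map_mem_iff, ordSet_mem_iff]
    exact h
  comp_mem := by
    rintro f ⟨a, ha, hfa⟩ g ⟨b, hb, hgb⟩
    refine ⟨a.comp b, ?_, fun o => ?_⟩
    · have hab : ⇑(a.comp b) = a ∘ b := rfl
      rcases ha with ha | ha
      · rwa [hab, ha, Function.id_comp]
      · rcases hb with hb | hb
        · rw [hab, hb, Function.comp_id]
          exact .inr ha
        · exact .inr (ha.comp hb)
    · rw [ElementaryEmbedding.comp_apply, hgb, hfa, Function.comp_apply]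
  exists_app := by
    rintro f ⟨a, ha, hfa⟩ g ⟨b, hb, hgb⟩
    rcases ha with ha | ha
    · have hf : f = id := funext fun o => ordSet_injective (by rw [← hfa, ha, id, id])
      subst hf
      exact ⟨g, ⟨b, hb, hgb⟩, fun _ => rfl, fun _ h => h⟩
    rcases hb with hb | hb
    · have hg : g = id := funext fun o => ordSet_injective (by rw [← hgb, hb, id, id])
      subst hg
      exact ⟨id, ⟨b, .inl hb, hgb⟩, fun _ => rfl, fun _ _ _ _ => rfl⟩
    obtain ⟨c, hc⟩ := exists_isApplication hlam a b
    obtain ⟨c, rfl⟩ := hc.exists_elementary hlam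
    obtain ⟨h, hh⟩ := exists_action c
    refine ⟨h, ⟨c, .inr (.app ha hb hc), hh⟩, fun o => ordSet_injective ?_, fun γ hγ o ho => ?_⟩
    · rw [← hh, ← hfa, hc.apply_apply hlam, hgb, hfa]
    · apply ordSet_injective
      rw [← hh]
      refine hc.eq_self_of_mem hlam (w := ordSet γ) (fun z hz => ?_) _ ?_
      · obtain ⟨o', rfl⟩ := exists_ordSet_eq ((ZFSet.isOrdinal_toZFSet γ.1).mem hz)
        rw [hgb, hγ o' (ordSet_mem_iff.1 hz)]
      · rw [hfa]
        exact ordSet_mem_iff.2 ho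

lemma ack_le_numCriticalPoints (hlam : Order.IsSuccLimit lam)
    (j : VSet lam ↪ₑ[setLanguage] VSet lam) (hj : ∃ x, j x ≠ x) :
    ((ack 13 12 : ℕ) : ℕ∞) ≤ numCriticalPoints j 4 := by
  obtain ⟨κ, hκ⟩ := exists_isCriticalPoint hlam j hj
  have hG := isApplicative_ordinalActions hlam j
  obtain ⟨f, hf⟩ := exists_action j
  have hfG : f ∈ ordinalActions j := ⟨j, .inr .gen, hf⟩
  have hfix : ∀ a ∈ ordinalActions j, ∀ x < κ, a x = x := by
    rintro a ⟨e, he | he, ha⟩ x hx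
    · exact ordSet_injective (by rw [← ha, he, id])
    · apply ordSet_injective
      rw [← ha]
      exact he.eq_self_of_mem hlam hκ.2.2 _ (ordSet_mem_iff.2 hx)
  have hκf : κ < f κ := by
    have hne : f κ ≠ κ := fun h => hκ.2.1 (by rw [hf, h])
    exact lt_of_le_of_ne ((hG.strictMono f hfG).le_apply) hne.symm
  obtain ⟨s, hs, hsκ⟩ := (exists_long_chain hG hfG hfix hκf).exists_finset hG hκf
  have hsub : ordSet '' (s : Set (Set.Iio lam)) ⊆ criticalPointsBelow j 4 := by
    rintro _ ⟨γ, hγ, rfl⟩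
    obtain ⟨hγ4, g, hg, rfl⟩ := hsκ γ hγ
    -- `g κ` is the critical point of `g(j)`
    obtain ⟨c, ⟨e, he, hec⟩, hcg, hcfix⟩ := hG.exists_app g hg f hfG
    have hmove : e (ordSet (g κ)) ≠ ordSet (g κ) := by
      rw [hec, hcg]
      exact fun h => ((hG.strictMono g hg) hκf).ne' (ordSet_injective h)
    refine ⟨⟨e, he.resolve_left fun h => hmove (by rw [h, id]),
      ZFSet.isOrdinal_toZFSet _, hmove, fun β hβ => ?_⟩, ordSet κ, hκ, ?_⟩
    · obtain ⟨o, rfl⟩ := exists_ordSet_eq ((ZFSet.isOrdinal_toZFSet _).mem hβ)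
      rw [hec, hcfix κ (hfix f hfG) o (ordSet_mem_iff.1 hβ)]
    · simp only [Function.iterate_succ, Function.iterate_zero, Function.comp_apply, id, hf]
      exact ordSet_mem_iff.2 hγ4
  calc ((ack 13 12 : ℕ) : ℕ∞) = (ordSet '' (s : Set (Set.Iio lam))).encard := by
        rw [ordSet_injective.encard_image, Set.encard_coe_eq_coe_finsetCard, hs]
    _ ≤ numCriticalPoints j 4 := Set.encard_le_encard hsub

/-! ### Values of the Ackermann function -/

lemma ack_ack_ack_lt : ack 9 (ack 8 (ack 8 254)) < ack 13 12 := by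
  have h1 : 254 ≤ ack 9 253 := by have := lt_ack_right 9 253; omega
  have h2 : ack 8 254 ≤ ack 9 254 := by
    rw [ack_succ_succ 8 253]
    exact ack_mono_right 8 h1
  have h3 : ack 8 (ack 8 254) ≤ ack 9 255 := by
    rw [ack_succ_succ 8 254]
    exact ack_mono_right 8 h2
  have h4 : 255 ≤ ack 10 10 := by
    have h : ack 3 10 ≤ ack 10 10 := ack_mono_left 10 (by norm_num)
    rw [ack_three] at h
    omega
  calc ack 9 (ack 8 (ack 8 254)) ≤ ack 9 (ack 9 (ack 10 10)) :=
        ack_mono_right 9 (h3.trans (ack_mono_right 9 h4))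
    _ = ack 10 12 := by rw [ack_succ_succ 9 11, ack_succ_succ 9 10]
    _ < ack 13 12 := ack_strictMono_left 12 (by norm_num)

lemma ack_five_one_lt : ack 5 1 < ack 4 (ack 4 254) := by
  have h : ack 5 1 = ack 4 (ack 4 1) := by rw [ack_succ_succ 4 0, ack_succ_zero]
  rw [h]
  exact ack_strictMono_right 4 (ack_strictMono_right 4 (by norm_num))

end EmbeddingAlgebra

theorem mainTheorem1 (lam : Ordinal.{u}) (hlam : Order.IsSuccLimit lam)
    (j : FirstOrder.Language.ElementaryEmbedding EmbeddingAlgebra.setLanguage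
      (EmbeddingAlgebra.VSet lam) (EmbeddingAlgebra.VSet lam))
    (hj : ∃ x, j x ≠ x) :
    ((ack 9 (ack 8 (ack 8 254)) : ℕ) : ℕ∞) < EmbeddingAlgebra.numCriticalPoints j 4 ∧
    ((ack 9 (ack 8 (ack 4 254)) : ℕ) : ℕ∞) < EmbeddingAlgebra.numCriticalPoints j 4 ∧
    ((ack 4 (ack 4 254) : ℕ) : ℕ∞) < EmbeddingAlgebra.numCriticalPoints j 4 ∧
    ack 5 1 < ack 4 (ack 4 254) := by
  have h := EmbeddingAlgebra.ack_le_numCriticalPoints hlam j hj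
  have key : ∀ m : ℕ, m ≤ ack 9 (ack 8 (ack 8 254)) →
      (m : ℕ∞) < EmbeddingAlgebra.numCriticalPoints j 4 := fun m hm =>
    (Nat.cast_lt.2 (hm.trans_lt EmbeddingAlgebra.ack_ack_ack_lt)).trans_le h
  have h48 : ack 4 254 ≤ ack 8 254 := ack_mono_left 254 (by norm_num)
  refine ⟨key _ le_rfl, key _ (ack_mono_right 9 (ack_mono_right 8 h48)), key _ ?_,
    EmbeddingAlgebra.ack_five_one_lt⟩
  exact (ack_le_ack (by norm_num : 4 ≤ 8) h48).trans (lt_ack_right 9 _).le
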